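/- Let $d\ge 1$ be an integer. An observable on $\mathbb{C}^D$ is a Hermitian operator with eigenvalues in $\{1,-1\}$. For sets $X,Y$ of measurement settings, joint correlations $E=(E[\alpha\beta|xy])_{x\in X,\,y\in Y}$ are called pure-$D$-quantum-realizable if there are a unit vector $\psi\in\mathbb{C}^D\otimes\mathbb{C}^D$ and observables $A_x$ $(x\in X)$ and $B_y$ $(y\in Y)$ on $\mathbb{C}^D$ such that $E[\alpha\beta|xy]=\langle\psi|A_x\otimes B_y|\psi\rangle$ for all $x,y$. They are called $D$-quantum-realizable if they are a probabilistic mixture (over an arbitrary probability space of shared randomness) of pure-$D$-quantum-realizable correlations, and finitely quantum-realizable if they are $D$-quantum-realizable for some finite $D$. Then: (1) There are correlations with finitely many settings for each party that are finitely quantum-realizable but not $d$-quantum-realizable. (2) Let $n=2d^2+1$ and let both parties' settings be the unit vectors in $\mathbb{R}^n$. The correlations $E[\alpha\beta|ab]=a\cdot b$ are realized by the maximally entangled state $D^{-1/2}\sum_{i=1}^{D}|i\rangle\otimes|i\rangle$ with $D=2^{\lfloor n/2\rfloor}$ and suitable observables $A_a$, $B_b$ on $\mathbb{C}^D$; so they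 are finitely quantum-realizable. They are not $d$-quantum-realizable. (3) For every $n>2d^2$ there is $\varepsilon\in(0,1)$ for which finite $\varepsilon$-nets of the unit sphere of $\mathbb{R}^n$ exist, and such that for every finite $\varepsilon$-net $N$ (a set $N$ of unit vectors such that every unit vector $a$ has some $u\in N$ with $\|a-u\|\le\varepsilon$) the correlations $E[\alpha\beta|uv]=u\cdot v$, $u,v\in N$, are finitely quantum-realizable but not $d$-quantum-realizable. -/

import Mathlib

open scoped Matrix Kronecker
open MeasureTheory

/-- An observable on `ℂ^d`: a Hermitian matrix whose eigenvalues lie in `{1, -1}`. -/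
def IsObservable {d : ℕ} (A : Matrix (Fin d) (Fin d) ℂ) : Prop :=
  A.IsHermitian ∧ spectrum ℂ A ⊆ {1, -1}

/-- A pure state of `ℂ^d ⊗ ℂ^d` (identified with `ℂ^(d × d)` through the product basis):
a unit vector. -/
def IsPureState {d : ℕ} (ψ : Fin d × Fin d → ℂ) : Prop :=
  star ψ ⬝ᵥ ψ = 1

/-- The expectation `⟨ψ| A ⊗ B |ψ⟩`. -/
def jointExpectation {d : ℕ} (ψ : Fin d × Fin d → ℂ) (A B : Matrix (Fin d) (Fin d) ℂ) : ℂ :=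
  star ψ ⬝ᵥ ((A ⊗ₖ B) *ᵥ ψ)

/-- The joint correlations `E x y` (settings `x : X` for Alice and `y : Y` for Bob) are
pure-`d`-quantum-realizable. -/
def IsPureQuantumRealizable {X Y : Type*} (d : ℕ) (E : X → Y → ℝ) : Prop :=
  ∃ (ψ : Fin d × Fin d → ℂ) (A : X → Matrix (Fin d) (Fin d) ℂ) (B : Y → Matrix (Fin d) (Fin d) ℂ),
    IsPureState ψ ∧ (∀ x, IsObservable (A x)) ∧ (∀ y, IsObservable (B y)) ∧
      ∀ x y, (E x y : ℂ) = jointExpectation ψ (A x) (B y)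

/-- The joint correlations `E` are `d`-quantum-realizable: a probabilistic mixture of
pure-`d`-quantum-realizable correlations. The mixture is over an arbitrary probability space `Λ`
(the shared randomness), so that finite convex combinations are included. -/
def IsQuantumRealizable {X Y : Type*} (d : ℕ) (E : X → Y → ℝ) : Prop :=
  ∃ (Λ : Type) (_ : MeasurableSpace Λ) (μ : Measure Λ) (C : Λ → X → Y → ℝ),
    IsProbabilityMeasure μ ∧ (∀ l, IsPureQuantumRealizable d (C l)) ∧
      ∀ x y, Integrable (fun l => C l x y) μ ∧ E x y = ∫ l, C l x y ∂μ

/-- The joint correlations `E` are `d`-quantum-realizable for some finite `d`. -/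
def IsFinitelyQuantumRealizable {X Y : Type*} (E : X → Y → ℝ) : Prop :=
  ∃ d : ℕ, IsQuantumRealizable d E

/-- The standard maximally entangled state `D^(-1/2) ∑ i, |i⟩ ⊗ |i⟩` of `ℂ^D ⊗ ℂ^D`. -/
noncomputable def maxEntangledState (D : ℕ) : Fin D × Fin D → ℂ :=
  fun p => if p.1 = p.2 then ((Real.sqrt D)⁻¹ : ℝ) else 0

/-- The unit sphere of `ℝ^n`. -/
def unitSphere (n : ℕ) : Set (EuclideanSpace ℝ (Fin n)) :=
  Metric.sphere 0 1

/-- The correlations `E[αβ|ab] = a · b`, both parties' settings being the vectors in `S`. -/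
noncomputable def innerCorrelation {n : ℕ} (S : Set (EuclideanSpace ℝ (Fin n))) : S → S → ℝ :=
  fun a b => inner ℝ (a : EuclideanSpace ℝ (Fin n)) (b : EuclideanSpace ℝ (Fin n))

/-- `N` is an `ε`-net for the unit sphere of `ℝ^n`. -/
def IsSphereNet {n : ℕ} (ε : ℝ) (N : Set (EuclideanSpace ℝ (Fin n))) : Prop :=
  N ⊆ unitSphere n ∧ ∀ a ∈ unitSphere n, ∃ u ∈ N, ‖a - u‖ ≤ ε

/-! Lower bound: the vectors `(A ⊗ 1) ψ` and `(1 ⊗ B) ψ` turn pure correlations into inner products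
of unit vectors in a real space of dimension `2 d ^ 2`. Since `u · u = 1` is extremal, almost every
term of a mixture uses one and the same vector for `u` on both sides. Averaging Gram matrices then
shows that linear relations among the net vectors pass to almost every term, so some term gives a
linear map `L` with `‖L u‖ = 1` on the net (`exists_linearMap_of_isQuantumRealizable`). If `n > 2 d
^ 2`, `L` has a kernel, which a fine enough net forbids (`finrank_le_of_norm_eq_one_on_net`). Upper
bound: Clifford matrices on the maximally entangled state realize `a · b`
(`exists_observables_inner`). -/

lemma IsObservable.mul_self {d : ℕ} {A : Matrix (Fin d) (Fin d) ℂ} (hA : IsObservable A) :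
    A * A = 1 := by
  have hsa : IsSelfAdjoint A := hA.1
  calc A * A = cfc (fun x : ℝ => x * x) A := by
        rw [cfc_mul _ _ A, cfc_id' ℝ A]
    _ = cfc (fun _ : ℝ => 1) A := by
        refine cfc_congr fun x hx => ?_
        have hx' := hA.2 ((spectrum.algebraMap_mem_iff ℂ).2 hx)
        simp only [Complex.coe_algebraMap, Set.mem_insert_iff, Set.mem_singleton_iff] at hx'
        have hx2 : x = 1 ∨ x = -1 := by exact_mod_cast hx'
        rcases hx2 with rfl | rfl <;> simp
    _ = 1 := cfc_const_one ℝ A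

lemma isObservable_of_mul_self {d : ℕ} {A : Matrix (Fin d) (Fin d) ℂ} (hA : A.IsHermitian)
    (h : A * A = 1) : IsObservable A := by
  refine ⟨hA, fun x hx => ?_⟩
  have hx2 : x ^ 2 ∈ spectrum ℂ (A ^ 2) := spectrum.pow_mem_pow A 2 hx
  rw [pow_two A, h] at hx2
  by_contra hne
  simp only [Set.mem_insert_iff, Set.mem_singleton_iff, not_or] at hne
  rcases subsingleton_or_nontrivial (Matrix (Fin d) (Fin d) ℂ) with hs | hs
  · simp at hx2
  · rw [spectrum.one_eq, Set.mem_singleton_iff, sq_eq_one_iff] at hx2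
    tauto

lemma pureQuantumRealizable_vectors {X Y : Type*} {d : ℕ} {C : X → Y → ℝ}
    (h : IsPureQuantumRealizable d C) :
    ∃ (f : X → EuclideanSpace ℂ (Fin d × Fin d)) (g : Y → EuclideanSpace ℂ (Fin d × Fin d)),
      (∀ x, ‖f x‖ = 1) ∧ (∀ y, ‖g y‖ = 1) ∧ ∀ x y, C x y = inner ℝ (f x) (g y) := by
  obtain ⟨ψ, A, B, hψ, hA, hB, hC⟩ := h
  have inner_eq : ∀ M M' : Matrix (Fin d × Fin d) (Fin d × Fin d) ℂ,
      inner ℂ (WithLp.toLp 2 (M *ᵥ ψ)) (WithLp.toLp 2 (M' *ᵥ ψ)) =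
        star ψ ⬝ᵥ ((Mᴴ * M') *ᵥ ψ) := by
    intro M M'
    rw [EuclideanSpace.inner_toLp_toLp, dotProduct_comm, Matrix.star_mulVec,
      ← Matrix.dotProduct_mulVec, Matrix.mulVec_mulVec]
  have norm_eq : ∀ M : Matrix (Fin d × Fin d) (Fin d × Fin d) ℂ, Mᴴ * M = 1 →
      ‖WithLp.toLp 2 (M *ᵥ ψ)‖ = 1 := by
    intro M hM
    have h1 := inner_self_eq_norm_sq_to_K (𝕜 := ℂ) (WithLp.toLp 2 (M *ᵥ ψ))
    rw [inner_eq, hM, Matrix.one_mulVec, hψ] at h1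
    have h2 : ‖WithLp.toLp 2 (M *ᵥ ψ)‖ ^ 2 = 1 := Complex.ofReal_injective (by simpa using h1.symm)
    exact (pow_eq_one_iff_of_nonneg (norm_nonneg _) two_ne_zero).1 h2
  refine ⟨fun x => WithLp.toLp 2 ((A x ⊗ₖ 1) *ᵥ ψ), fun y => WithLp.toLp 2 ((1 ⊗ₖ B y) *ᵥ ψ),
    fun x => norm_eq _ ?_, fun y => norm_eq _ ?_, fun x y => ?_⟩
  · rw [Matrix.conjTranspose_kronecker, (hA x).1.eq, ← Matrix.mul_kronecker_mul, (hA x).mul_self]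
    simp
  · rw [Matrix.conjTranspose_kronecker, (hB y).1.eq, ← Matrix.mul_kronecker_mul, (hB y).mul_self]
    simp
  · have inner_re : ∀ v w : EuclideanSpace ℂ (Fin d × Fin d), inner ℝ v w = (inner ℂ v w).re := by
      intro v w
      rw [PiLp.inner_apply, PiLp.inner_apply, Complex.re_sum]
      rfl
    rw [inner_re, inner_eq, Matrix.conjTranspose_kronecker, (hA x).1.eq,
      ← Matrix.mul_kronecker_mul, Matrix.conjTranspose_one, mul_one, one_mul,
      ← jointExpectation, ← hC x y]
    simp

lemma LinearMap.exists_comp_eq_of_ker_le {K U V W : Type*} [Field K] [AddCommGroup U] [Module K U]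
    [AddCommGroup V] [Module K V] [AddCommGroup W] [Module K W] (T : U →ₗ[K] V) (S : U →ₗ[K] W)
    (h : LinearMap.ker T ≤ LinearMap.ker S) : ∃ L : V →ₗ[K] W, L ∘ₗ T = S := by
  obtain ⟨s, hs⟩ := T.rangeRestrict.exists_rightInverse_of_surjective T.range_rangeRestrict
  obtain ⟨L, hL⟩ := LinearMap.exists_extend (S ∘ₗ s)
  refine ⟨L, LinearMap.ext fun x => ?_⟩
  have h1 : L (T x) = S (s (T.rangeRestrict x)) := LinearMap.congr_fun hL (T.rangeRestrict x)
  have h2 : T.rangeRestrict (s (T.rangeRestrict x)) = T.rangeRestrict x := LinearMap.congr_fun hs _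
  have h3 : s (T.rangeRestrict x) - x ∈ LinearMap.ker T := by
    rw [LinearMap.mem_ker, map_sub, sub_eq_zero]
    exact congrArg Subtype.val h2
  have h4 := h h3
  rw [LinearMap.mem_ker, map_sub, sub_eq_zero] at h4
  rw [LinearMap.comp_apply, h1, h4]

lemma exists_linearMap_of_isQuantumRealizable {n d : ℕ} {N : Set (EuclideanSpace ℝ (Fin n))}
    (hfin : N.Finite) (hN : N ⊆ unitSphere n) (h : IsQuantumRealizable d (innerCorrelation N)) :
    ∃ L : EuclideanSpace ℝ (Fin n) →ₗ[ℝ] EuclideanSpace ℂ (Fin d × Fin d),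
      ∀ u ∈ N, ‖L u‖ = 1 := by
  obtain ⟨Λ, _, μ, C, hμ, hC, hE⟩ := h
  have : Fintype N := hfin.fintype
  choose f g hf hg hfg using fun l => pureQuantumRealizable_vectors (hC l)
  -- A mean of numbers at most `1` equals `1` only if almost all of them do; this is the equality
  -- case of Cauchy-Schwarz.
  have hdiag : ∀ u : N, ∀ᵐ l ∂μ, f l u = g l u := by
    intro u
    have hle : ∀ l, C l u u ≤ 1 := fun l => by
      rw [hfg]
      simpa [hf, hg] using real_inner_le_norm (f l u) (g l u)
    have hint : ∫ l, (1 - C l u u) ∂μ = 0 := by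
      rw [integral_sub (integrable_const _) (hE u u).1, ← (hE u u).2]
      have : ‖(u : EuclideanSpace ℝ (Fin n))‖ = 1 := by simpa [unitSphere] using hN u.2
      simp [innerCorrelation, this]
    rw [integral_eq_zero_iff_of_nonneg (fun l => sub_nonneg.2 (hle l))
      ((integrable_const _).sub (hE u u).1)] at hint
    filter_upwards [hint] with l hl
    have h1 : inner ℝ (f l u) (g l u) = 1 := by
      rw [← hfg]
      exact (sub_eq_zero.1 hl).symm
    exact (inner_eq_one_iff_of_norm_eq_one (hf l u) (hg l u)).1 h1
  have hgram : ∀ᵐ l ∂μ, ∀ u v, C l u v = inner ℝ (f l u) (f l v) := by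
    filter_upwards [ae_all_iff.2 hdiag] with l hl u v
    rw [hfg, hl v]
  let T : (N → ℝ) →ₗ[ℝ] EuclideanSpace ℝ (Fin n) :=
    Fintype.linearCombination ℝ (fun u : N => (u : EuclideanSpace ℝ (Fin n)))
  -- The mean over `l` of `‖∑ c u • f l u‖ ^ 2` is `‖T c‖ ^ 2 = 0`. The integrand is written through
  -- `C`, as `f` was chosen without measurability in `l`.
  have hrel : ∀ c ∈ LinearMap.ker T, ∀ᵐ l ∂μ, Fintype.linearCombination ℝ (f l) c = 0 := by
    intro c hc
    have hi : ∀ u v : N, Integrable (fun l => c u * (c v * C l u v)) μ := fun u v =>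
      ((hE u v).1.const_mul _).const_mul _
    have hsum : Integrable (fun l => ∑ u, ∑ v, c u * (c v * C l u v)) μ :=
      integrable_finsetSum _ fun u _ => integrable_finsetSum _ fun v _ => hi u v
    have hsq : ∀ᵐ l ∂μ, ∑ u, ∑ v, c u * (c v * C l u v) =
        ‖Fintype.linearCombination ℝ (f l) c‖ ^ 2 := by
      filter_upwards [hgram] with l hl
      rw [← real_inner_self_eq_norm_sq, Fintype.linearCombination_apply, sum_inner]
      simp_rw [inner_sum, real_inner_smul_left, real_inner_smul_right, hl]
    have hint : ∫ l, ∑ u, ∑ v, c u * (c v * C l u v) ∂μ = 0 := by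
      rw [integral_finsetSum _ fun u _ => integrable_finsetSum _ fun v _ => hi u v]
      simp_rw [integral_finsetSum _ fun v _ => hi _ v, integral_const_mul, ← (hE _ _).2]
      have h0 : inner ℝ (T c) (T c) = 0 := by
        rw [LinearMap.mem_ker.1 hc, inner_zero_left]
      rw [Fintype.linearCombination_apply, sum_inner] at h0
      simp_rw [inner_sum, real_inner_smul_left, real_inner_smul_right] at h0
      exact h0
    rw [integral_eq_zero_iff_of_nonneg_ae
      (hsq.mono fun l hl => by simp only [hl, Pi.zero_apply]; positivity) hsum] at hint
    filter_upwards [hint, hsq] with l h1 h2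
    rw [h1] at h2
    exact norm_eq_zero.1 (pow_eq_zero_iff two_ne_zero |>.1 h2.symm)
  -- The exceptional null set depends on `c`; finitely many generators leave one `l` good for the
  -- whole kernel.
  obtain ⟨s, hs⟩ := (IsNoetherian.noetherian (LinearMap.ker T) : (LinearMap.ker T).FG)
  have hall : ∀ᵐ l ∂μ, ∀ c : s, Fintype.linearCombination ℝ (f l) c = 0 :=
    ae_all_iff.2 fun c => hrel c (hs ▸ Submodule.subset_span c.2)
  obtain ⟨l, hl⟩ := hall.exists
  obtain ⟨L, hL⟩ := T.exists_comp_eq_of_ker_le (Fintype.linearCombination ℝ (f l)) (by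
    rw [← hs, Submodule.span_le]
    exact fun c hc => hl ⟨c, hc⟩)
  refine ⟨L, fun u hu => ?_⟩
  classical
  have h1 := LinearMap.congr_fun hL (Pi.single ⟨u, hu⟩ 1)
  simp only [T, LinearMap.comp_apply, Fintype.linearCombination_apply_single, one_smul] at h1
  rw [h1, hf]

/-- A unit kernel vector lies within `ε` of some `u` in the net, so `1 = ‖L u‖ ≤ ‖L‖ ε`.
Approximating any unit vector gives `‖L‖ ≤ 1 + ‖L‖ ε`. Together `‖L‖ ≤ 2 ε ‖L‖`, impossible for `ε <
1 / 2`. -/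
lemma finrank_le_of_norm_eq_one_on_net {n : ℕ} {V : Type*} [NormedAddCommGroup V]
    [NormedSpace ℝ V] [FiniteDimensional ℝ V] {ε : ℝ} (hε : ε < 1 / 2)
    {N : Set (EuclideanSpace ℝ (Fin n))} (hN : IsSphereNet ε N)
    (L : EuclideanSpace ℝ (Fin n) →ₗ[ℝ] V) (hL : ∀ u ∈ N, ‖L u‖ = 1) :
    n ≤ Module.finrank ℝ V := by
  by_contra! hlt
  let M := LinearMap.toContinuousLinearMap L
  have hM : ∀ u ∈ N, ‖M u‖ = 1 := hL
  have hker : LinearMap.ker L ≠ ⊥ := LinearMap.ker_ne_bot_of_finrank_lt (by simpa using hlt)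
  obtain ⟨x, hx, hx0⟩ := Submodule.exists_mem_ne_zero_of_ne_bot hker
  have hk1 : ‖‖x‖⁻¹ • x‖ = 1 := norm_smul_inv_norm (𝕜 := ℝ) hx0
  have hk0 : M (‖x‖⁻¹ • x) = 0 := (LinearMap.ker L).smul_mem _ hx
  obtain ⟨u, hu, hku⟩ := hN.2 (‖x‖⁻¹ • x) (by simpa [unitSphere] using hk1)
  have hε0 : 0 ≤ ε := (norm_nonneg _).trans hku
  have hsub : ∀ a w, ‖a - w‖ ≤ ε → ‖M a - M w‖ ≤ ‖M‖ * ε := fun a w h => by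
    rw [← map_sub]
    exact M.le_opNorm_of_le h
  have hnorm : ‖M‖ ≤ 1 + ‖M‖ * ε := by
    refine ContinuousLinearMap.opNorm_le_of_unit_norm (by positivity) fun a ha => ?_
    obtain ⟨w, hw, haw⟩ := hN.2 a (by simpa [unitSphere] using ha)
    calc ‖M a‖ ≤ ‖M w‖ + ‖M a - M w‖ := norm_le_norm_add_norm_sub' _ _
      _ ≤ 1 + ‖M‖ * ε := by rw [hM w hw]; gcongr; exact hsub a w haw
  have h1 := hsub _ _ hku
  rw [hk0, zero_sub, norm_neg, hM u hu] at h1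
  nlinarith [norm_nonneg M]

lemma not_isQuantumRealizable_of_net {n d : ℕ} (hn : 2 * d ^ 2 < n) {ε : ℝ} (hε : ε < 1 / 2)
    {N : Set (EuclideanSpace ℝ (Fin n))} (hfin : N.Finite) (hN : IsSphereNet ε N) :
    ¬ IsQuantumRealizable d (innerCorrelation N) := by
  intro h
  obtain ⟨L, hL⟩ := exists_linearMap_of_isQuantumRealizable hfin hN.1 h
  have := finrank_le_of_norm_eq_one_on_net hε hN L hL
  rw [finrank_real_of_complex, finrank_euclideanSpace, Fintype.card_prod, Fintype.card_fin] at this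
  nlinarith

lemma IsPureQuantumRealizable.comp {X Y X' Y' : Type*} {d : ℕ} {E : X → Y → ℝ}
    (h : IsPureQuantumRealizable d E) (p : X' → X) (q : Y' → Y) :
    IsPureQuantumRealizable d (fun x y => E (p x) (q y)) := by
  obtain ⟨ψ, A, B, hψ, hA, hB, hE⟩ := h
  exact ⟨ψ, A ∘ p, B ∘ q, hψ, fun x => hA _, fun y => hB _, fun x y => hE _ _⟩

lemma IsQuantumRealizable.comp {X Y X' Y' : Type*} {d : ℕ} {E : X → Y → ℝ}
    (h : IsQuantumRealizable d E) (p : X' → X) (q : Y' → Y) :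
    IsQuantumRealizable d (fun x y => E (p x) (q y)) := by
  obtain ⟨Λ, m, μ, C, hμ, hC, hE⟩ := h
  exact ⟨Λ, m, μ, fun l x y => C l (p x) (q y), hμ, fun l => (hC l).comp p q, fun x y => hE _ _⟩

lemma IsPureQuantumRealizable.isQuantumRealizable {X Y : Type*} {d : ℕ} {E : X → Y → ℝ}
    (h : IsPureQuantumRealizable d E) : IsQuantumRealizable d E :=
  ⟨Unit, inferInstance, Measure.dirac (), fun _ => E, inferInstance, fun _ => h,
    fun x y => ⟨integrable_const _, by simp⟩⟩

lemma exists_finite_isSphereNet (n : ℕ) {ε : ℝ} (hε : 0 < ε) :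
    ∃ N : Set (EuclideanSpace ℝ (Fin n)), N.Finite ∧ IsSphereNet ε N := by
  obtain ⟨N, hN, hfin, hcover⟩ :=
    (isCompact_sphere (0 : EuclideanSpace ℝ (Fin n)) 1).finite_cover_balls hε
  refine ⟨N, hfin, hN, fun a ha => ?_⟩
  obtain ⟨u, hu, hau⟩ := Set.mem_iUnion₂.1 (hcover ha)
  exact ⟨u, hu, by rw [← dist_eq_norm]; exact (Metric.mem_ball.1 hau).le⟩

/-! ### Clifford matrices and Tsirelson's realization -/

/-- A family of Hermitian matrices that satisfies the Clifford relations. -/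
def IsCliffordFamily {ι m : Type*} [DecidableEq ι] [Fintype m] [DecidableEq m]
    (Γ : ι → Matrix m m ℂ) : Prop :=
  (∀ i, (Γ i).IsHermitian) ∧ ∀ i j, Γ i * Γ j + Γ j * Γ i = if i = j then (2 : ℂ) • 1 else 0

lemma exists_pauli_matrices :
    ∃ X Y Z : Matrix (Fin 2) (Fin 2) ℂ, X.IsHermitian ∧ Y.IsHermitian ∧ Z.IsHermitian ∧
      X * X = 1 ∧ Y * Y = 1 ∧ Z * Z = 1 ∧
      X * Y = -(Y * X) ∧ X * Z = -(Z * X) ∧ Y * Z = -(Z * Y) := by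
  refine ⟨!![0, 1; 1, 0], !![0, -Complex.I; Complex.I, 0], !![1, 0; 0, -1], ?_⟩
  refine ⟨?_, ?_, ?_, ?_, ?_, ?_, ?_, ?_, ?_⟩ <;> ext i j <;> fin_cases i <;> fin_cases j <;>
    simp [Matrix.mul_apply]

/-- Each extra qubit adds two generators: `Γ i ⊗ X`, `1 ⊗ Y` and `1 ⊗ Z` inherit the relations from
the Pauli matrices. -/
lemma exists_isCliffordFamily (k : ℕ) :
    ∃ Γ : Fin (2 * k + 1) → Matrix (Fin (2 ^ k)) (Fin (2 ^ k)) ℂ, IsCliffordFamily Γ := by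
  induction k with
  | zero =>
    refine ⟨fun _ => 1, fun _ => Matrix.isHermitian_one, fun i j => ?_⟩
    rw [if_pos (Subsingleton.elim (α := Fin 1) i j), mul_one, two_smul]
  | succ k ih =>
    obtain ⟨Γ, hΓ, hrel⟩ := ih
    obtain ⟨X, Y, Z, hX, hY, hZ, hXX, hYY, hZZ, hXY, hXZ, hYZ⟩ := exists_pauli_matrices
    let e : Fin (2 ^ k) × Fin 2 ≃ Fin (2 ^ (k + 1)) := finProdFinEquiv
    let Δ : Fin (2 * k + 1 + 1 + 1) → Matrix (Fin (2 ^ k) × Fin 2) (Fin (2 ^ k) × Fin 2) ℂ :=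
      Fin.cons (1 ⊗ₖ Y) (Fin.cons (1 ⊗ₖ Z) fun i => Γ i ⊗ₖ X)
    have hΔ : IsCliffordFamily Δ := by
      have neg_kron : ∀ (A : Matrix (Fin (2 ^ k)) (Fin (2 ^ k)) ℂ) (B : Matrix (Fin 2) (Fin 2) ℂ),
          A ⊗ₖ (-B) = -(A ⊗ₖ B) := fun A B => by ext; simp
      refine ⟨fun i => ?_, fun i j => ?_⟩
      · have hkron : ∀ {A : Matrix (Fin (2 ^ k)) (Fin (2 ^ k)) ℂ} {B : Matrix (Fin 2) (Fin 2) ℂ},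
            A.IsHermitian → B.IsHermitian → (A ⊗ₖ B).IsHermitian := fun hA hB => by
          rw [Matrix.IsHermitian, Matrix.conjTranspose_kronecker, hA.eq, hB.eq]
        refine Fin.cases ?_ (fun i => Fin.cases ?_ (fun i => ?_) i) i
        · exact hkron Matrix.isHermitian_one hY
        · exact hkron Matrix.isHermitian_one hZ
        · exact hkron (hΓ i) hX
      · refine Fin.cases ?_ (fun i => Fin.cases ?_ (fun i => ?_) i) i <;>
          refine Fin.cases ?_ (fun j => Fin.cases ?_ (fun j => ?_) j) j <;>
          simp only [Δ, Fin.cons_zero, Fin.cons_succ, ← Matrix.mul_kronecker_mul, hXX, hYY, hZZ,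
            hXY, hXZ, hYZ, one_mul, mul_one, Matrix.one_kronecker_one, neg_kron, neg_add_cancel,
            add_neg_cancel, ← two_smul ℂ (1 : Matrix (Fin (2 ^ k) × Fin 2) _ ℂ), if_true, Fin.succ_inj, Fin.succ_ne_zero,
            (Fin.succ_ne_zero _).symm, if_false, ← Matrix.add_kronecker, hrel]
        split_ifs
        · rw [Matrix.smul_kronecker, Matrix.one_kronecker_one]
        · exact Matrix.zero_kronecker _
    refine ⟨fun i => Matrix.reindexAlgEquiv ℂ ℂ e (Δ i), fun i => ?_, fun i j => ?_⟩
    · exact (hΔ.1 i).submatrix _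
    · rw [← map_mul, ← map_mul, ← map_add, hΔ.2]
      split_ifs
      · rw [map_smul, map_one]
      · exact map_zero _

lemma jointExpectation_maxEntangledState (D : ℕ) (A B : Matrix (Fin D) (Fin D) ℂ) :
    jointExpectation (maxEntangledState D) A Bᵀ = (D : ℂ)⁻¹ * (A * B).trace := by
  have hD : ((Real.sqrt D : ℂ))⁻¹ * ((Real.sqrt D : ℂ))⁻¹ = (D : ℂ)⁻¹ := by
    rw [← mul_inv, ← Complex.ofReal_mul, Real.mul_self_sqrt (Nat.cast_nonneg _),
      Complex.ofReal_natCast]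
  simp only [jointExpectation, maxEntangledState, dotProduct, Matrix.mulVec,
    Fintype.sum_prod_type, Matrix.trace, Matrix.diag, Matrix.mul_apply,
    Matrix.kroneckerMap_apply, Matrix.transpose_apply, Pi.star_apply, apply_ite star, mul_ite,
    ite_mul, star_zero, mul_zero, zero_mul, Finset.sum_ite_eq, Finset.mem_univ, if_true]
  simp only [Finset.mul_sum]
  refine Finset.sum_congr rfl fun i _ => Finset.sum_congr rfl fun j _ => ?_
  rw [← hD]
  simp
  ring

lemma isPureState_maxEntangledState {D : ℕ} (hD : D ≠ 0) : IsPureState (maxEntangledState D) := by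
  have h := jointExpectation_maxEntangledState D 1 1
  rw [Matrix.transpose_one, jointExpectation, Matrix.one_kronecker_one, Matrix.one_mulVec] at h
  rw [IsPureState, h]
  simp [hD]

/-- Tsirelson's realization of the inner product of unit vectors on the maximally entangled
state. -/
lemma exists_observables_inner {n : ℕ} {S : Set (EuclideanSpace ℝ (Fin n))}
    (hS : S ⊆ unitSphere n) :
    ∃ A B : S → Matrix (Fin (2 ^ (n / 2))) (Fin (2 ^ (n / 2))) ℂ,
      IsPureState (maxEntangledState (2 ^ (n / 2))) ∧
      (∀ a, IsObservable (A a)) ∧ (∀ b, IsObservable (B b)) ∧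
      ∀ a b, (innerCorrelation S a b : ℂ) =
        jointExpectation (maxEntangledState (2 ^ (n / 2))) (A a) (B b) := by
  obtain ⟨Γ, hΓ, hrel⟩ := exists_isCliffordFamily (n / 2)
  -- For even `n` one generator is left over.
  have hn : n ≤ 2 * (n / 2) + 1 := by omega
  let A : EuclideanSpace ℝ (Fin n) → Matrix (Fin (2 ^ (n / 2))) (Fin (2 ^ (n / 2))) ℂ :=
    fun a => ∑ i, (a i : ℂ) • Γ (Fin.castLE hn i)
  have hherm : ∀ a, (A a).IsHermitian := fun a => by
    rw [Matrix.IsHermitian, Matrix.conjTranspose_sum]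
    refine Finset.sum_congr rfl fun i _ => ?_
    rw [Matrix.conjTranspose_smul, (hΓ _).eq]
    simp
  -- Taking `a = b` gives the involution property; the trace gives the correlation.
  have hanti : ∀ a b, A a * A b + A b * A a = (2 * (inner ℝ a b : ℝ) : ℂ) • 1 := fun a b => by
    have h1 : A b * A a = ∑ i, ∑ j, ((a i : ℂ) * b j) •
        (Γ (Fin.castLE hn j) * Γ (Fin.castLE hn i)) := by
      simp only [A, Finset.sum_mul_sum, smul_mul_smul_comm]
      rw [Finset.sum_comm]
      simp only [mul_comm]
    rw [h1]
    simp only [A, Finset.sum_mul_sum, smul_mul_smul_comm, ← Finset.sum_add_distrib, ← smul_add,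
      hrel, (Fin.castLE_injective hn).eq_iff, smul_ite, smul_zero, Finset.sum_ite_eq,
      Finset.mem_univ, if_true]
    rw [← Finset.sum_smul, smul_smul, mul_comm]
    congr 2
    simp [PiLp.inner_apply, mul_comm]
  have hsq : ∀ a ∈ S, A a * A a = 1 := fun a ha => by
    have ha1 : ‖a‖ = 1 := by simpa [unitSphere] using hS ha
    have h := hanti a a
    rw [real_inner_self_eq_norm_sq, ha1, ← two_smul ℂ (A a * A a)] at h
    simpa using h
  have hobs : ∀ a ∈ S, IsObservable (A a) := fun a ha =>
    isObservable_of_mul_self (hherm a) (hsq a ha)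
  refine ⟨fun a => A a, fun b => (A b)ᵀ, isPureState_maxEntangledState (by positivity),
    fun a => hobs a a.2, fun b => isObservable_of_mul_self (hherm b).transpose ?_, fun a b => ?_⟩
  · rw [← Matrix.transpose_mul, hsq b b.2, Matrix.transpose_one]
  · have h := congrArg Matrix.trace (hanti a b)
    rw [Matrix.trace_add, Matrix.trace_mul_comm (A b), ← two_mul, Matrix.trace_smul,
      Matrix.trace_one, Fintype.card_fin, smul_eq_mul, mul_assoc] at h
    rw [jointExpectation_maxEntangledState, mul_left_cancel₀ two_ne_zero h, mul_left_comm,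
      inv_mul_cancel₀ (by simp), mul_one, innerCorrelation]

lemma isFinitelyQuantumRealizable_innerCorrelation {n : ℕ} {S : Set (EuclideanSpace ℝ (Fin n))}
    (hS : S ⊆ unitSphere n) : IsFinitelyQuantumRealizable (innerCorrelation S) := by
  obtain ⟨A, B, h⟩ := exists_observables_inner hS
  have : IsPureQuantumRealizable _ (innerCorrelation S) := ⟨_, A, B, h⟩
  exact ⟨_, this.isQuantumRealizable⟩

theorem theorem2 (d : ℕ) (hd : 1 ≤ d) :
    -- correlations with finitely many settings
    (∃ (p q : ℕ) (E : Fin p → Fin q → ℝ),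
      IsFinitelyQuantumRealizable E ∧ ¬ IsQuantumRealizable d E) ∧
    -- the correlations `a · b` on the whole unit sphere of `ℝ^n`, where `n = 2 d ^ 2 + 1`
    (∀ n : ℕ, n = 2 * d ^ 2 + 1 →
      (∃ A B : unitSphere n → Matrix (Fin (2 ^ (n / 2))) (Fin (2 ^ (n / 2))) ℂ,
        IsPureState (maxEntangledState (2 ^ (n / 2))) ∧
        (∀ a, IsObservable (A a)) ∧ (∀ b, IsObservable (B b)) ∧
        ∀ a b, (innerCorrelation (unitSphere n) a b : ℂ) =
          jointExpectation (maxEntangledState (2 ^ (n / 2))) (A a) (B b)) ∧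
      IsFinitelyQuantumRealizable (innerCorrelation (unitSphere n)) ∧
      ¬ IsQuantumRealizable d (innerCorrelation (unitSphere n))) ∧
    -- the correlations `a · b` on finite nets of the unit sphere of `ℝ^n`, where `n > 2 d ^ 2`
    (∀ n : ℕ, 2 * d ^ 2 < n → ∃ ε : ℝ, 0 < ε ∧ ε < 1 ∧
      (∃ N : Set (EuclideanSpace ℝ (Fin n)), N.Finite ∧ IsSphereNet ε N) ∧
      ∀ N : Set (EuclideanSpace ℝ (Fin n)), N.Finite → IsSphereNet ε N →
        IsFinitelyQuantumRealizable (innerCorrelation N) ∧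
        ¬ IsQuantumRealizable d (innerCorrelation N)) := by
  refine ⟨?_, fun n hn => ?_, fun n hn => ?_⟩
  · obtain ⟨N, hfin, hN⟩ := exists_finite_isSphereNet (2 * d ^ 2 + 1) (ε := 1 / 4) (by norm_num)
    have : Fintype N := hfin.fintype
    let e := (Fintype.equivFin N).symm
    refine ⟨_, _, fun i j => innerCorrelation N (e i) (e j), ?_, fun h => ?_⟩
    · obtain ⟨D, hD⟩ := isFinitelyQuantumRealizable_innerCorrelation hN.1
      exact ⟨D, hD.comp e e⟩
    · refine not_isQuantumRealizable_of_net (d := d) (by omega) (by norm_num) hfin hN ?_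
      simpa using h.comp e.symm e.symm
  · refine ⟨exists_observables_inner le_rfl, isFinitelyQuantumRealizable_innerCorrelation le_rfl,
      fun h => ?_⟩
    -- The averaging argument needs finitely many settings, so the sphere is restricted to a net;
    -- any `ε` in `(0, 1 / 2)` would do.
    obtain ⟨N, hfin, hN⟩ := exists_finite_isSphereNet n (ε := 1 / 4) (by norm_num)
    exact not_isQuantumRealizable_of_net (d := d) (by omega) (by norm_num) hfin hN
      (h.comp (Set.inclusion hN.1) (Set.inclusion hN.1))
  · exact ⟨1 / 4, by norm_num, by norm_num, exists_finite_isSphereNet n (by norm_num),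
      fun N hfin hN => ⟨isFinitelyQuantumRealizable_innerCorrelation hN.1,
        not_isQuantumRealizable_of_net hn (by norm_num) hfin hN⟩⟩
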